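/- **Setting.** Let $\mathcal H_\pi$ (policies) and $\mathcal H_r$ (rewards) be reproducing kernel Hilbert spaces whose kernels satisfy the Hilbert–Schmidt condition and have positive Mercer eigenvalues $(\mu_{\pi,j})_{j\ge1}$, $(\mu_{r,j})_{j\ge1}$. They are represented by coefficient sequences in the Mercer eigenfunctions: with $\mu_{i,j}>0$ and $\sum_j\mu_{i,j}^2<\infty$ for $i\in\{\pi,r\}$, $$\mathcal H_i=\Big\{\kappa\in\ell^2(\mathbb N):\sum_j \kappa_j^2/\mu_{i,j}<\infty\Big\},\qquad \langle\kappa,\kappa'\rangle_{\mathcal H_i}=\sum_j\frac{\kappa_j\kappa'_j}{\mu_{i,j}},\qquad S_i=\mathrm{diag}(\mu_{i,j}^{-1}).$$ Let $M:\mathcal H_\pi\to\mathcal H_r$ be a compact linear map, $F(\pi,r)=\langle r,M\pi\rangle_{\mathcal H_r}$, and $\tilde M=S_r^{1/2}MS_\pi^{-1/2}$, so that $\tilde M^\top\tilde M=S_\pi^{-1/2}M^\top S_rMS_\pi^{-1/2}$ on $\ell^2(\mathbb N)$. Let $\phi_1,\phi_2,\dots$ be orthonormal eigenvectors of $\tilde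 M^\top\tilde M$ for its non-zero eigenvalues $\zeta_1\ge\zeta_2\ge\dots$, listed with multiplicity, and put $\pi_j=S_\pi^{-1/2}\phi_j$. Let $C_\pi$ be a subset of the unit ball of $\mathcal H_\pi$ that is regular with constant $c_\pi>0$: for every $j$ there is $\tilde\pi_j\in C_\pi$ with $\tilde\pi_j\tilde\pi_j^\top\succeq c_\pi\,\pi_j\pi_j^\top$. Let $r^*\in\mathcal H_r$ with $\|r^*\|_{\mathcal H_r}=1$ be the true reward, let $\pi^*\in\arg\max_{\pi\in C_\pi}F(\pi,r^*)$, and let $\Delta(\hat\pi;r^*)=F(\pi^*,r^*)-F(\hat\pi,r^*)$ be the excess risk. **Algorithm.** Given $n\ge1$, an integer $J$ and $\lambda>0$, choose $\tilde\pi_1,\dots,\tilde\pi_J\in C_\pi$ as above, and let the query set $(q_1,\dots,q_n)$ contain each $\tilde\pi_j$ ($j\le J$) $n/J$ times (rounded up or down if $J\nmid n$). Observe $y_i=F(q_i,r^*)+\epsilon_i$ with $\epsilon_i$ i.i.d. $\mathcal N(0,\tau^2)$, compute the ridge estimate $$\hat r=\arg\min_{r\in\mathcal H_r}\ \frac1n\sum_{i=1}^n\big(y_i-\langle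 r,Mq_i\rangle_{\mathcal H_r}\big)^2+\lambda\|r\|_{\mathcal H_r}^2,$$ and output a plug-in policy $\hat\pi_{\rm plug}\in\arg\max_{\pi\in C_\pi}F(\pi,\hat r)$. **Corollary.** Suppose $\zeta_j\asymp j^{-\beta}$ with $\beta>0$, that is, $a\,j^{-\beta}\le\zeta_j\le A\,j^{-\beta}$ for all $j\ge1$, with constants $a,A>0$. Then, with $J=n^{1/(\beta+2)}$ (rounded to a neighbouring integer if it is not one) and $\lambda=n^{-(\beta+1)/(\beta+2)}$, for every $n\ge1$, $$\mathbb E\big[\Delta(\hat\pi_{\rm plug};r^*)\big]\le c\,n^{-\frac{\beta}{2(\beta+2)}},$$ where $c>0$ depends only on $\tau^2$, $c_\pi$ and $A$. In particular $c$ does not depend on $n$, $\beta$, $a$, the spaces, $M$, $C_\pi$ or $r^*$. -/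

import Mathlib

open MeasureTheory ProbabilityTheory
open scoped NNReal InnerProductSpace

namespace DoublyNonparametric

noncomputable section

/-- The Hilbert space `ℓ²(ℕ)` of real square-summable sequences. -/
abbrev SeqL2 : Type := lp (fun _ : ℕ => ℝ) 2

/-- The spectrum `(μ_j)` of a kernel satisfying the Hilbert-Schmidt condition: a sequence of
positive eigenvalues (so that `S = diag (μ_j⁻¹)` makes sense) with `∑ μ_j² < ∞`
(this sum is the squared Hilbert-Schmidt norm of the kernel). -/
structure KernelSpectrum where
  eig : ℕ → ℝ
  pos : ∀ j, 0 < eig j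
  hilbertSchmidt : Summable fun j => eig j ^ 2

theorem summable_iff_mem (x : ℕ → ℝ) : Summable (fun j => x j ^ 2) ↔ Memℓp x 2 := by
  rw [memℓp_gen_iff (by norm_num)]
  simp

theorem SeqL2.summable_sq (x : SeqL2) : Summable (fun j => x j ^ 2) :=
  (summable_iff_mem _).2 (lp.memℓp x)

theorem KernelSpectrum.exists_bound (μ : KernelSpectrum) : ∃ B : ℝ, ∀ j, μ.eig j ≤ B := by
  refine ⟨1 + ∑' j, μ.eig j ^ 2, fun j => ?_⟩
  have h := μ.hilbertSchmidt.le_tsum j (fun i _ => sq_nonneg _)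
  nlinarith [sq_nonneg (μ.eig j - 1)]

/-- The coefficient sequences `κ ∈ ℓ²(ℕ)` with `∑ κ_j² / μ_j < ∞`. -/
def ellipsoidSubmodule (μ : KernelSpectrum) : Submodule ℝ SeqL2 where
  carrier := {κ | Summable fun j => κ j ^ 2 / μ.eig j}
  zero_mem' := by simp
  add_mem' := by
    intro a b ha hb
    have ha' : Summable fun j => a j ^ 2 / μ.eig j := ha
    have hb' : Summable fun j => b j ^ 2 / μ.eig j := hb
    change Summable fun j => (a j + b j) ^ 2 / μ.eig j
    refine Summable.of_nonneg_of_le (fun j => ?_) (fun j => ?_)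
      ((ha'.mul_left 2).add (hb'.mul_left 2))
    · have := μ.pos j
      positivity
    · have := μ.pos j
      rw [← mul_div_assoc, ← mul_div_assoc, ← add_div]
      gcongr
      nlinarith [sq_nonneg (a j - b j)]
  smul_mem' := by
    intro c a ha
    have ha' : Summable fun j => a j ^ 2 / μ.eig j := ha
    change Summable fun j => (c * a j) ^ 2 / μ.eig j
    refine (ha'.mul_left (c ^ 2)).congr fun j => ?_
    ring

/-- The reproducing kernel Hilbert space with kernel spectrum `μ`, in its `ℓ²(ℕ)` representation:
the sequences of coefficients with respect to the Mercer eigenfunctions. It carries the inner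
product `∑ x_j y_j / μ_j` (see below), not the one of `ℓ²(ℕ)`. -/
def RKHSpace (μ : KernelSpectrum) : Type := ellipsoidSubmodule μ

variable {μ : KernelSpectrum}

instance : AddCommGroup (RKHSpace μ) := inferInstanceAs (AddCommGroup (ellipsoidSubmodule μ))

instance : Module ℝ (RKHSpace μ) := inferInstanceAs (Module ℝ (ellipsoidSubmodule μ))

/-- The coefficient sequence of an element, as a vector of `ℓ²(ℕ)`. -/
def RKHSpace.coeff : RKHSpace μ →ₗ[ℝ] SeqL2 := (ellipsoidSubmodule μ).subtype

theorem RKHSpace.coeff_injective : Function.Injective (RKHSpace.coeff (μ := μ)) :=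
  Subtype.coe_injective

theorem RKHSpace.summable_coeff (x : RKHSpace μ) :
    Summable fun j => x.coeff j ^ 2 / μ.eig j := x.2

theorem RKHSpace.summable_mul (x y : RKHSpace μ) :
    Summable fun j => x.coeff j * y.coeff j / μ.eig j := by
  refine Summable.of_norm_bounded (x.summable_coeff.add y.summable_coeff) fun j => ?_
  have h := μ.pos j
  rw [Real.norm_eq_abs, abs_div, abs_of_pos h, ← add_div]
  gcongr
  rw [abs_le]
  constructor <;> nlinarith [sq_nonneg (x.coeff j + y.coeff j), sq_nonneg (x.coeff j - y.coeff j)]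

/-- The inner product `⟨x, y⟩ = ∑ x_j y_j / μ_j`. -/
@[reducible] def RKHSpace.core (μ : KernelSpectrum) : InnerProductSpace.Core ℝ (RKHSpace μ) where
  inner x y := ∑' j, x.coeff j * y.coeff j / μ.eig j
  conj_inner_symm x y := by
    simp only [conj_trivial]
    exact tsum_congr fun j => by ring
  re_inner_nonneg x := by
    refine tsum_nonneg fun j => ?_
    have := μ.pos j
    have := mul_self_nonneg (x.coeff j)
    positivity
  add_left x y z := by
    rw [← (x.summable_mul z).tsum_add (y.summable_mul z)]
    refine tsum_congr fun j => ?_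
    rw [map_add, lp.coeFn_add, Pi.add_apply]
    ring
  smul_left x y r := by
    rw [conj_trivial, ← tsum_mul_left]
    refine tsum_congr fun j => ?_
    rw [map_smul, lp.coeFn_smul, Pi.smul_apply, smul_eq_mul]
    ring
  definite x hx := by
    have h0 : ∀ j, 0 ≤ x.coeff j * x.coeff j / μ.eig j := fun j =>
      div_nonneg (mul_self_nonneg _) (μ.pos j).le
    have h1 := (x.summable_mul x).hasSum
    rw [show ∑' j, x.coeff j * x.coeff j / μ.eig j = 0 from hx,
      hasSum_zero_iff_of_nonneg h0] at h1
    apply RKHSpace.coeff_injective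
    rw [map_zero]
    ext j
    have h2 := congrFun h1 j
    have h3 := (μ.pos j).ne'
    simpa [h3] using h2

instance : NormedAddCommGroup (RKHSpace μ) := (RKHSpace.core μ).toNormedAddCommGroup

instance : InnerProductSpace ℝ (RKHSpace μ) := InnerProductSpace.ofCore (RKHSpace.core μ).toCore

theorem RKHSpace.inner_def (x y : RKHSpace μ) :
    ⟪x, y⟫_ℝ = ∑' j, x.coeff j * y.coeff j / μ.eig j := rfl

/-- The map `S^{1/2} = diag (μ_j^{-1/2})`, which sends the Hilbert space with spectrum `μ`
isometrically onto `ℓ²(ℕ)`. -/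
def sqrtS (μ : KernelSpectrum) : RKHSpace μ ≃ₗᵢ[ℝ] SeqL2 where
  toFun x := ⟨fun j => x.coeff j / √(μ.eig j), (summable_iff_mem _).1 (by
    refine x.summable_coeff.congr fun j => ?_
    rw [div_pow, Real.sq_sqrt (μ.pos j).le])⟩
  map_add' x y := by
    ext j
    change (x + y).coeff j / _ = x.coeff j / _ + y.coeff j / _
    rw [map_add, lp.coeFn_add, Pi.add_apply, add_div]
  map_smul' c x := by
    ext j
    change (c • x).coeff j / _ = c * (x.coeff j / _)
    rw [map_smul, lp.coeFn_smul, Pi.smul_apply, smul_eq_mul, mul_div_assoc]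
  invFun y := ⟨⟨fun j => √(μ.eig j) * y j, (summable_iff_mem _).1 (by
      obtain ⟨B, hB⟩ := μ.exists_bound
      refine Summable.of_nonneg_of_le (fun j => sq_nonneg _) (fun j => ?_)
        (y.summable_sq.mul_left B)
      rw [mul_pow, Real.sq_sqrt (μ.pos j).le]
      exact mul_le_mul_of_nonneg_right (hB j) (sq_nonneg _))⟩, by
    change Summable fun j => (√(μ.eig j) * y j) ^ 2 / μ.eig j
    refine y.summable_sq.congr fun j => ?_
    rw [mul_pow, Real.sq_sqrt (μ.pos j).le]
    have := (μ.pos j).ne'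
    field_simp⟩
  left_inv x := by
    apply RKHSpace.coeff_injective
    ext j
    change √(μ.eig j) * (x.coeff j / √(μ.eig j)) = x.coeff j
    have := (Real.sqrt_pos.2 (μ.pos j)).ne'
    field_simp
  right_inv y := by
    ext j
    change √(μ.eig j) * y j / √(μ.eig j) = y j
    have := (Real.sqrt_pos.2 (μ.pos j)).ne'
    field_simp
  norm_map' x := by
    refine (sq_eq_sq₀ (norm_nonneg _) (norm_nonneg _)).1 ?_
    rw [← real_inner_self_eq_norm_sq, ← real_inner_self_eq_norm_sq, lp.inner_eq_tsum,
      RKHSpace.inner_def]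
    refine tsum_congr fun j => ?_
    change (x.coeff j / √(μ.eig j)) * (x.coeff j / √(μ.eig j)) = _
    rw [div_mul_div_comm, Real.mul_self_sqrt (μ.pos j).le]

theorem sqrtS_apply (x : RKHSpace μ) (j : ℕ) : sqrtS μ x j = x.coeff j / √(μ.eig j) := rfl

instance : CompleteSpace (RKHSpace μ) :=
  (sqrtS μ).toIsometryEquiv.completeSpace

variable {μπ μr : KernelSpectrum}

/-- The evaluation functional `F(π, r) = ⟨r, M π⟩` of the reward space. -/
def reward (M : RKHSpace μπ →L[ℝ] RKHSpace μr) (p : RKHSpace μπ) (r : RKHSpace μr) : ℝ :=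
  ⟪r, M p⟫_ℝ

/-- The excess risk `Δ = F(π*, r*) - F(π̂, r*)`. -/
def excessRisk (M : RKHSpace μπ →L[ℝ] RKHSpace μr) (rstar : RKHSpace μr)
    (pstar p : RKHSpace μπ) : ℝ :=
  reward M pstar rstar - reward M p rstar

/-- The operator `M̃ = S_r^{1/2} M S_π^{-1/2}` on `ℓ²(ℕ)`. -/
def whitenedMap (M : RKHSpace μπ →L[ℝ] RKHSpace μr) : SeqL2 →L[ℝ] SeqL2 :=
  (sqrtS μr).toContinuousLinearEquiv.toContinuousLinearMap ∘L M ∘L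
    (sqrtS μπ).symm.toContinuousLinearEquiv.toContinuousLinearMap

/-- The operator `S_π^{-1/2} Mᵀ S_r M S_π^{-1/2} = M̃ᵀ M̃` on `ℓ²(ℕ)`. -/
def whitenedGram (M : RKHSpace μπ →L[ℝ] RKHSpace μr) : SeqL2 →L[ℝ] SeqL2 :=
  ContinuousLinearMap.adjoint (whitenedMap M) ∘L whitenedMap M

/-- `(φ_j, ζ_j)` is an ordered eigendecomposition of `T`: orthonormal eigenvectors, eigenvalues
in decreasing order and repeated with multiplicity, and nothing is missed, since `T` vanishes on
the orthogonal complement of the `φ_j`. For a positive compact `T` the `ζ_j` are the singular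
values of `T`. -/
structure IsEigendecomposition (T : SeqL2 →L[ℝ] SeqL2) (φ : ℕ → SeqL2) (ζ : ℕ → ℝ) : Prop where
  orthonormal : Orthonormal ℝ φ
  eigen : ∀ j, T (φ j) = ζ j • φ j
  antitone : Antitone ζ
  complete : ∀ x, (∀ j, ⟪φ j, x⟫_ℝ = 0) → T x = 0

/-- The policy `π_j = S_π^{-1/2} φ_j` attached to an eigenvector `φ_j`. -/
def eigenPolicy (μ : KernelSpectrum) (v : SeqL2) : RKHSpace μ := (sqrtS μ).symm v

/-- The infinite matrix `π πᵀ`, as an operator on `ℓ²(ℕ)`. -/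
def outer (p : RKHSpace μ) : SeqL2 →L[ℝ] SeqL2 := InnerProductSpace.rankOne ℝ p.coeff p.coeff

/-- The Loewner relation `π̃ π̃ᵀ ⪰ c · π πᵀ`. -/
def Dominates (c : ℝ) (q p : RKHSpace μ) : Prop := c • outer p ≤ outer q

/-- The regularity assumption on the policy set: for every eigenvector `φ_j` some policy `π̃_j` in
the set satisfies `π̃_j π̃_jᵀ ⪰ c · π_j π_jᵀ`, where `π_j = S_π^{-1/2} φ_j`. -/
def RegularPolicySet (C : Set (RKHSpace μ)) (φ : ℕ → SeqL2) (c : ℝ) : Prop :=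
  ∀ j, ∃ q ∈ C, Dominates c q (eigenPolicy μ (φ j))

/-- The passive querying strategy with exploration parameter `J`. It chooses policies
`π̃_0, …, π̃_{J-1}` in `C` with `π̃_j π̃_jᵀ ⪰ c · π_j π_jᵀ` for the `J` leading eigenvectors and spends
the `n` queries on them, `n / J` queries on each (rounded down or up if `J` does not divide `n`).
Here `query i` is the policy of the `i`-th query. -/
def IsQuerySet (C : Set (RKHSpace μ)) (φ : ℕ → SeqL2) (c : ℝ) (J n : ℕ)
    (query : Fin n → RKHSpace μ) : Prop :=
  ∃ (q : ℕ → RKHSpace μ) (idx : Fin n → Fin J),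
    (∀ j < J, q j ∈ C ∧ Dominates c (q j) (eigenPolicy μ (φ j))) ∧
    (∀ j : Fin J, Nat.card {i // idx i = j} = ⌊(n : ℝ) / J⌋₊ ∨
      Nat.card {i // idx i = j} = ⌈(n : ℝ) / J⌉₊) ∧
    ∀ i, query i = q (idx i)

/-- The ridge regression objective `(1/n) ∑ (y_i - ⟨r, M π_i⟩)² + lam ‖r‖²`. -/
def ridgeObjective (M : RKHSpace μπ →L[ℝ] RKHSpace μr) {n : ℕ} (query : Fin n → RKHSpace μπ)
    (y : Fin n → ℝ) (lam : ℝ) (r : RKHSpace μr) : ℝ :=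
  (1 / n : ℝ) * ∑ i, (y i - ⟪r, M (query i)⟫_ℝ) ^ 2 + lam * ‖r‖ ^ 2

end

end DoublyNonparametric

open DoublyNonparametric

/-!
The regularity condition compares rank-one operators, so it forces each queried policy to be a
multiple `α • p j` of an eigenpolicy `p j`, with `α² ≥ cπ` (`Dominates.exists_eq_smul`). The
eigenpolicies are orthonormal and their images `M (p j)` are orthogonal with squared norms `ζ j`
(`IsSingularSystem`), so ridge regression decouples along the directions `M (p j)`.

If `rhat` is the ridge estimate and `e = rhat - rstar`, then a plug-in policy from the unit ball has
regret at most `2 ‖Mᵀ e‖` (`regret_le_two_mul_norm_adjoint`), and `‖Mᵀ e‖² = ∑ ⟪e, M (p j)⟫²`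
(`IsSingularSystem.hasSum_inner_sq`). By the normal equation, each explored coordinate of `e` is an
average of a noise term and of a coordinate of `-rstar`, whereas the coordinates `j ≥ J` of `e` are
those of `-rstar` (`ridge_error_coord`). With `∑ ⟪rstar, M (p j)⟫² / ζ j ≤ ‖rstar‖² = 1`, the bias is
of order `J lam / cπ`, the tail is of order `ζ J`, and the expected squared noise is of order
`τ² J² / (n cπ)` (`norm_adjoint_ridge_error_sq_le`, `integrable_and_integral_sum_sq`). The given
`J` and `lam` make all three of order `R² = n^{-β/(β+2)}` (`exploration_rates`), and
`2 ‖Mᵀ e‖ ≤ R + ‖Mᵀ e‖² / R` turns this into a bound of order `R` for the expected regret.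
-/

namespace DoublyNonparametric

/-! ### Complete systems of singular vectors -/

section SingularSystem

variable {H K : Type*} [NormedAddCommGroup H] [InnerProductSpace ℝ H]
  [NormedAddCommGroup K] [InnerProductSpace ℝ K]

/-- `p` is an orthonormal system of right singular vectors of `M` with squared singular values
`ζ j`, and it is complete: `M` vanishes on its orthogonal complement. -/
structure IsSingularSystem (M : H →L[ℝ] K) (p : ℕ → H) (ζ : ℕ → ℝ) : Prop where
  orthonormal : Orthonormal ℝ p
  inner_map : ∀ i j, ⟪M (p i), M (p j)⟫_ℝ = if i = j then ζ j else 0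
  complete : ∀ x, (∀ j, ⟪p j, x⟫_ℝ = 0) → M x = 0

/-- Parseval's identity for `Mᵀ e`, which is orthogonal to the kernel of `M` and hence lies in the
closed span of the singular vectors. -/
theorem IsSingularSystem.hasSum_inner_sq [CompleteSpace H] [CompleteSpace K] {M : H →L[ℝ] K}
    {p : ℕ → H} {ζ : ℕ → ℝ} (h : IsSingularSystem M p ζ) (e : K) :
    HasSum (fun j => ⟪e, M (p j)⟫_ℝ ^ 2) (‖ContinuousLinearMap.adjoint M e‖ ^ 2) := by
  set g := ContinuousLinearMap.adjoint M e with hg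
  have hc : ∀ j, ⟪e, M (p j)⟫_ℝ = ⟪p j, g⟫_ℝ := fun j => by
    rw [hg, ContinuousLinearMap.adjoint_inner_right, real_inner_comm]
  simp only [hc]
  -- `y` is the projection of `g` onto the closed span; `g - y` lies in the kernel of `M`.
  have hs : Summable fun j => ⟪p j, g⟫_ℝ • p j := by
    have := h.orthonormal.orthogonalFamily.summable_iff_norm_sq_summable
      (fun j => ⟪p j, g⟫_ℝ)
    simp only [LinearIsometry.toSpanSingleton_apply] at this
    exact this.2 (h.orthonormal.inner_products_summable g)
  obtain ⟨y, hy⟩ := hs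
  have hpy : ∀ k, ⟪p k, y⟫_ℝ = ⟪p k, g⟫_ℝ := fun k => by
    have h1 := hy.mapL (innerSL ℝ (p k))
    refine h1.unique ?_
    have h2 := hasSum_single (f := fun j => innerSL ℝ (p k) (⟪p j, g⟫_ℝ • p j)) k fun j hj => by
      simp [h.orthonormal.2 hj.symm]
    simpa [inner_smul_right, real_inner_self_eq_norm_sq, h.orthonormal.1 k] using h2
  have hM : M (g - y) = 0 := h.complete _ fun j => by rw [inner_sub_right, hpy, sub_self]
  have hgy : ⟪g, g - y⟫_ℝ = 0 := by
    rw [hg, ContinuousLinearMap.adjoint_inner_left, ← hg, hM, inner_zero_right]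
  have hn : ‖g‖ ^ 2 = ⟪g, y⟫_ℝ := by
    rw [← real_inner_self_eq_norm_sq]
    rw [inner_sub_right] at hgy
    linarith
  rw [hn]
  have h2 := hy.mapL (innerSL ℝ g)
  simp only [innerSL_apply_apply, inner_smul_right] at h2
  have h3 : (fun j => ⟪p j, g⟫_ℝ ^ 2) = fun j => ⟪p j, g⟫_ℝ * ⟪g, p j⟫_ℝ := by
    funext j
    rw [real_inner_comm (p j) g, sq]
  rw [h3]
  exact h2

/-- Bessel's inequality for the left singular vectors `M (p j) / √(ζ j)`. -/
theorem IsSingularSystem.summable_and_tsum_inner_sq_div_le {M : H →L[ℝ] K}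
    {p : ℕ → H} {ζ : ℕ → ℝ} (h : IsSingularSystem M p ζ) (hζ : ∀ j, 0 < ζ j) (r : K) :
    Summable (fun j => ⟪r, M (p j)⟫_ℝ ^ 2 / ζ j) ∧
      ∑' j, ⟪r, M (p j)⟫_ℝ ^ 2 / ζ j ≤ ‖r‖ ^ 2 := by
  have hu : Orthonormal ℝ fun j => (√(ζ j))⁻¹ • M (p j) := by
    rw [orthonormal_iff_ite]
    intro i j
    rw [real_inner_smul_left, real_inner_smul_right, h.inner_map]
    split_ifs with hij
    · subst hij
      have := Real.mul_self_sqrt (hζ i).le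
      have h0 := (Real.sqrt_pos.2 (hζ i)).ne'
      field_simp
      linarith
    · simp
  have he : ∀ j, ⟪r, M (p j)⟫_ℝ ^ 2 / ζ j = ‖⟪(√(ζ j))⁻¹ • M (p j), r⟫_ℝ‖ ^ 2 := fun j => by
    rw [real_inner_smul_left, Real.norm_eq_abs, sq_abs, mul_pow, inv_pow,
      Real.sq_sqrt (hζ j).le, real_inner_comm]
    ring
  simp only [he]
  exact ⟨hu.inner_products_summable r, hu.tsum_inner_products_le r⟩

end SingularSystem

/-! ### Ridge regression -/

section Ridge

variable {K : Type*} [NormedAddCommGroup K] [InnerProductSpace ℝ K]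

/-- The first-order condition of ridge regression. -/
theorem ridge_normal_equation {n : ℕ} {d : Fin n → K} {y : Fin n → ℝ} {lam : ℝ} {rhat : K}
    (hmin : IsMinOn (fun r => (1 / n : ℝ) * ∑ i, (y i - ⟪r, d i⟫_ℝ) ^ 2 + lam * ‖r‖ ^ 2)
      Set.univ rhat) (h : K) :
    (1 / n : ℝ) * ∑ i, (y i - ⟪rhat, d i⟫_ℝ) * ⟪h, d i⟫_ℝ = lam * ⟪rhat, h⟫_ℝ := by
  set G := (1 / n : ℝ) * ∑ i, (y i - ⟪rhat, d i⟫_ℝ) * ⟪h, d i⟫_ℝ with hG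
  set Q := (1 / n : ℝ) * ∑ i, ⟪h, d i⟫_ℝ ^ 2 + lam * ‖h‖ ^ 2 with hQ
  have key : ∀ t : ℝ, 0 ≤ t * (2 * (lam * ⟪rhat, h⟫_ℝ - G)) + t ^ 2 * Q := fun t => by
    have h1 := hmin (Set.mem_univ (rhat + t • h))
    simp only [Set.mem_ofPred_eq] at h1
    have h2 : ∑ i, (y i - ⟪rhat + t • h, d i⟫_ℝ) ^ 2 = ∑ i, (y i - ⟪rhat, d i⟫_ℝ) ^ 2
        - 2 * t * ∑ i, (y i - ⟪rhat, d i⟫_ℝ) * ⟪h, d i⟫_ℝ + t ^ 2 * ∑ i, ⟪h, d i⟫_ℝ ^ 2 := by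
      rw [Finset.mul_sum, Finset.mul_sum, ← Finset.sum_sub_distrib, ← Finset.sum_add_distrib]
      refine Finset.sum_congr rfl fun i _ => ?_
      rw [inner_add_left, real_inner_smul_left]
      ring
    have h3 : ‖rhat + t • h‖ ^ 2 = ‖rhat‖ ^ 2 + 2 * t * ⟪rhat, h⟫_ℝ + t ^ 2 * ‖h‖ ^ 2 := by
      rw [norm_add_sq_real, real_inner_smul_right, norm_smul, mul_pow, Real.norm_eq_abs, sq_abs]
      ring
    rw [h2, h3] at h1
    rw [hG, hQ]
    linarith
  set L := 2 * (lam * ⟪rhat, h⟫_ℝ - G) with hL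
  -- A quadratic `t L + t² Q` that is nonnegative for all `t` has no linear part.
  have hd : discrim Q L 0 ≤ 0 := discrim_le_zero fun t => by nlinarith [key t]
  rw [discrim] at hd
  have : L = 0 := by nlinarith [sq_nonneg L]
  linarith

end Ridge

/-- A convexity bound: `e` is an average of `x` and `-s` with weights `σ` and `lam`. -/
theorem sq_le_of_add_mul_eq {σ lam e x s : ℝ} (hσ : 0 < σ) (hlam : 0 < lam)
    (h : (σ + lam) * e = σ * x - lam * s) : e ^ 2 ≤ x ^ 2 + lam / σ * s ^ 2 := by
  have h1 : (σ + lam) * e ^ 2 ≤ σ * x ^ 2 + lam * s ^ 2 := by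
    have h2 : 0 < σ + lam := by positivity
    refine le_of_mul_le_mul_left ?_ h2
    have h3 : (σ + lam) * ((σ + lam) * e ^ 2) = (σ * x - lam * s) ^ 2 := by rw [← h]; ring
    rw [h3]
    nlinarith [mul_nonneg (mul_pos hσ hlam).le (sq_nonneg (x + s))]
  have h2 : σ * e ^ 2 ≤ σ * (x ^ 2 + lam / σ * s ^ 2) := by
    have : σ * (x ^ 2 + lam / σ * s ^ 2) = σ * x ^ 2 + lam * s ^ 2 := by field_simp
    rw [this]
    nlinarith [mul_nonneg hlam.le (sq_nonneg e)]
  exact le_of_mul_le_mul_left h2 hσ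

/-! ### Error of the ridge estimate and regret -/

section Error

variable {H K : Type*} [NormedAddCommGroup H] [InnerProductSpace ℝ H]
  [NormedAddCommGroup K] [InnerProductSpace ℝ K]

/-- The coordinates of the error of the ridge estimate along the singular vectors, when each query
is a multiple of a singular vector. With `m` queries in the direction `p j`, total noise `E` in
these queries and `σ = m α² ζ / n`, the coordinate is an average of `E / (m α)` (noise) and of the
coordinate of `-rstar` (bias), with weights proportional to `σ` and `lam`. -/
theorem ridge_error_coord {M : H →L[ℝ] K} {p : ℕ → H} {ζ : ℕ → ℝ} (h : IsSingularSystem M p ζ)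
    {n : ℕ} (hn : 0 < n) {query : Fin n → H} {α : ℕ → ℝ} {idx : Fin n → ℕ}
    (hq : ∀ i, query i = α (idx i) • p (idx i)) {rstar rhat : K} {ε : Fin n → ℝ} {lam : ℝ}
    (hmin : IsMinOn (fun r => (1 / n : ℝ) *
      ∑ i, (⟪rstar, M (query i)⟫_ℝ + ε i - ⟪r, M (query i)⟫_ℝ) ^ 2 + lam * ‖r‖ ^ 2)
      Set.univ rhat) (j : ℕ) (m : ℝ) (hm : m = (Finset.univ.filter fun i => idx i = j).card) :
    (m / n * α j ^ 2 * ζ j + lam) * ⟪rhat - rstar, M (p j)⟫_ℝ =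
      α j * ζ j / n * (∑ i with idx i = j, ε i) - lam * ⟪rstar, M (p j)⟫_ℝ := by
  have h1 := ridge_normal_equation hmin (M (p j))
  have h2 : ∀ i, (⟪rstar, M (query i)⟫_ℝ + ε i - ⟪rhat, M (query i)⟫_ℝ) *
      ⟪M (p j), M (query i)⟫_ℝ = if idx i = j then
        -(α j ^ 2 * ζ j * ⟪rhat - rstar, M (p j)⟫_ℝ) + α j * ζ j * ε i else 0 := fun i => by
    rw [hq i, map_smul, real_inner_smul_right (M (p j)), h.inner_map]
    by_cases hij : idx i = j
    · simp only [hij, if_true, inner_sub_left, real_inner_smul_right]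
      ring
    · simp [hij, Ne.symm hij]
  simp only [h2] at h1
  rw [← Finset.sum_filter, Finset.sum_add_distrib, Finset.sum_const, ← Finset.mul_sum,
    nsmul_eq_mul, ← hm] at h1
  rw [inner_sub_left] at h1 ⊢
  have hn' : (n : ℝ) ≠ 0 := by positivity
  field_simp at h1 ⊢
  linarith

/-- A pathwise bound for the error of the ridge estimate in the seminorm `e ↦ ‖Mᵀ e‖`, the one
that controls the regret. The factor `B` bounds the bias in every direction and the tail. -/
theorem norm_adjoint_ridge_error_sq_le [CompleteSpace H] [CompleteSpace K] {M : H →L[ℝ] K}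
    {p : ℕ → H} {ζ : ℕ → ℝ} (h : IsSingularSystem M p ζ) (hζ : ∀ j, 0 < ζ j)
    {n J : ℕ} (hn : 0 < n) {query : Fin n → H} {α : ℕ → ℝ} {idx : Fin n → ℕ}
    (hidx : ∀ i, idx i < J) (hq : ∀ i, query i = α (idx i) • p (idx i))
    {c m₀ : ℝ} (hc : 0 < c) (hα : ∀ j < J, c ≤ α j ^ 2) (hm₀ : 0 < m₀)
    (hm : ∀ j < J, m₀ ≤ (Finset.univ.filter fun i => idx i = j).card)
    {rstar rhat : K} (hr : ‖rstar‖ = 1) {ε : Fin n → ℝ} {lam : ℝ} (hlam : 0 < lam)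
    (hmin : IsMinOn (fun r => (1 / n : ℝ) *
      ∑ i, (⟪rstar, M (query i)⟫_ℝ + ε i - ⟪r, M (query i)⟫_ℝ) ^ 2 + lam * ‖r‖ ^ 2)
      Set.univ rhat)
    {B : ℝ} (hB : ∀ j, J ≤ j → ζ j ≤ B) (hB' : lam * n / (m₀ * c) ≤ B) :
    ‖ContinuousLinearMap.adjoint M (rhat - rstar)‖ ^ 2 ≤ B + ∑ j ∈ Finset.range J,
      (∑ i with idx i = j, ε i) ^ 2 /
        ((Finset.univ.filter fun i => idx i = j).card ^ 2 * c) := by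
  set N : ℕ → ℝ := fun j => (∑ i with idx i = j, ε i) ^ 2 /
        ((Finset.univ.filter fun i => idx i = j).card ^ 2 * c) with hN
  have hn' : (0 : ℝ) < n := by positivity
  obtain ⟨hs, hle⟩ := h.summable_and_tsum_inner_sq_div_le hζ rstar
  have hB0 : 0 ≤ B := le_trans (by positivity) hB'
  have hsum : HasSum (fun j => if j < J then N j else 0) (∑ j ∈ Finset.range J, N j) := by
    rw [← Finset.sum_congr rfl fun j hj => if_pos (c := j < J) (e := 0) (Finset.mem_range.1 hj)]
    exact hasSum_sum_of_ne_finset_zero fun j hj => if_neg fun h => hj (Finset.mem_range.2 h)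
  have hle' : ‖ContinuousLinearMap.adjoint M (rhat - rstar)‖ ^ 2 ≤
      B * (∑' j, ⟪rstar, M (p j)⟫_ℝ ^ 2 / ζ j) + ∑ j ∈ Finset.range J, N j := by
    refine hasSum_le (fun j => ?_) (h.hasSum_inner_sq (rhat - rstar))
      ((hs.hasSum.mul_left B).add hsum)
    have hco := ridge_error_coord h hn hq hmin j _ rfl
    have hζj := hζ j
    by_cases hj : j < J
    · rw [if_pos hj]
      have hαj := hα j hj
      have hmj := hm j hj
      generalize hmm : ((Finset.univ.filter fun i => idx i = j).card : ℝ) = m at hco hmj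
      have hm0 : 0 < m := hm₀.trans_le hmj
      have hα2 : 0 < α j ^ 2 := hc.trans_le hαj
      have hα0 : α j ≠ 0 := fun h0 => by simp [h0] at hα2
      set σ := m / n * α j ^ 2 * ζ j with hσ
      have hσ0 : 0 < σ := by positivity
      have h1 := sq_le_of_add_mul_eq (x := (∑ i with idx i = j, ε i) / (m * α j))
        (s := ⟪rstar, M (p j)⟫_ℝ) hσ0 hlam (by
        rw [hco, hσ]; field_simp)
      refine h1.trans ?_
      rw [add_comm]
      refine add_le_add ?_ ?_
      · have h2 : lam / σ * ⟪rstar, M (p j)⟫_ℝ ^ 2 =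
            lam * n / (m * α j ^ 2) * (⟪rstar, M (p j)⟫_ℝ ^ 2 / ζ j) := by
          rw [hσ]; field_simp
        rw [h2]
        refine mul_le_mul_of_nonneg_right (le_trans ?_ hB') (by positivity)
        gcongr
      · rw [hN]
        simp only [hmm]
        rw [div_pow, mul_pow]
        gcongr
    · rw [if_neg hj, add_zero]
      have hcard : (Finset.univ.filter fun i => idx i = j) = ∅ :=
        Finset.filter_eq_empty_iff.2 fun i _ hi => hj (hi ▸ hidx i)
      rw [hcard] at hco
      simp only [Finset.card_empty, Nat.cast_zero, zero_div, zero_mul, zero_add, Finset.sum_empty,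
        mul_zero, zero_sub] at hco
      -- No query sees the direction `p j`, so the penalty sets this coordinate of `rhat` to zero.
      have he : ⟪rhat - rstar, M (p j)⟫_ℝ = -⟪rstar, M (p j)⟫_ℝ := by
        apply mul_left_cancel₀ hlam.ne'
        linarith
      rw [he, neg_sq]
      have h3 : ⟪rstar, M (p j)⟫_ℝ ^ 2 = ζ j * (⟪rstar, M (p j)⟫_ℝ ^ 2 / ζ j) := by field_simp
      rw [h3, mul_div_cancel_left₀ _ hζj.ne']
      exact mul_le_mul_of_nonneg_right (hB j (not_lt.1 hj)) (by positivity)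
  refine hle'.trans (add_le_add ?_ le_rfl)
  rw [hr] at hle
  nlinarith

/-- The regret of a plug-in maximizer over a subset of the unit ball. -/
theorem regret_le_two_mul_norm_adjoint [CompleteSpace H] [CompleteSpace K] {M : H →L[ℝ] K}
    {C : Set H} (hC : C ⊆ Metric.closedBall 0 1) {rstar rhat : K} {pstar phat : H}
    (hps : pstar ∈ C) (hph : phat ∈ C) (hmax : IsMaxOn (fun p => ⟪rhat, M p⟫_ℝ) C phat) :
    ⟪rstar, M pstar⟫_ℝ - ⟪rstar, M phat⟫_ℝ ≤
      2 * ‖ContinuousLinearMap.adjoint M (rhat - rstar)‖ := by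
  have h1 : ⟪rhat, M pstar⟫_ℝ ≤ ⟪rhat, M phat⟫_ℝ := hmax hps
  have h2 : ⟪ContinuousLinearMap.adjoint M (rhat - rstar), phat - pstar⟫_ℝ =
      ⟪rhat, M phat⟫_ℝ - ⟪rhat, M pstar⟫_ℝ - (⟪rstar, M phat⟫_ℝ - ⟪rstar, M pstar⟫_ℝ) := by
    rw [ContinuousLinearMap.adjoint_inner_left, map_sub, inner_sub_left, inner_sub_right,
      inner_sub_right]
  have h3 := real_inner_le_norm (ContinuousLinearMap.adjoint M (rhat - rstar)) (phat - pstar)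
  have h4 : ‖phat - pstar‖ ≤ 2 := by
    have a1 := mem_closedBall_zero_iff.1 (hC hps)
    have a2 := mem_closedBall_zero_iff.1 (hC hph)
    linarith [norm_sub_le phat pstar]
  nlinarith [norm_nonneg (ContinuousLinearMap.adjoint M (rhat - rstar))]

end Error

/-! ### Moments of the noise -/

section Noise

variable {Ω ι : Type*} [MeasurableSpace Ω] {P : Measure Ω} [IsProbabilityMeasure P] {v : ℝ≥0}

/-- The second moment of a sum of independent centred Gaussian variables. -/
theorem integrable_and_integral_sum_sq {ε : ι → Ω → ℝ}
    (hε : ∀ i, HasLaw (ε i) (gaussianReal 0 v) P) (hind : iIndepFun ε P) (s : Finset ι) :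
    Integrable (fun ω => (∑ i ∈ s, ε i ω) ^ 2) P ∧
      ∫ ω, (∑ i ∈ s, ε i ω) ^ 2 ∂P = s.card * v := by
  have hL : ∀ i, MemLp (ε i) 2 P := fun i => by
    have h1 : MemLp id 2 (P.map (ε i)) := by
      rw [(hε i).map_eq]
      exact memLp_id_gaussianReal 2
    exact (memLp_map_measure_iff h1.1 (hε i).aemeasurable).1 h1
  have hLs : MemLp (fun ω => ∑ i ∈ s, ε i ω) 2 P := memLp_finsetSum s fun i _ => hL i
  refine ⟨hLs.integrable_sq, ?_⟩
  have hmean : ∫ ω, (∑ i ∈ s, ε i ω) ∂P = 0 := by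
    rw [integral_finsetSum s fun i _ => (hL i).integrable (by norm_num)]
    refine Finset.sum_eq_zero fun i _ => ?_
    rw [(hε i).integral_eq, integral_id_gaussianReal]
  rw [← variance_of_integral_eq_zero hLs.1.aemeasurable hmean]
  have := IndepFun.variance_sum (s := s) (fun i _ => hL i) (fun i _ j _ hij => hind.indepFun hij)
  rw [show (∑ i ∈ s, ε i) = fun ω => ∑ i ∈ s, ε i ω from by ext; simp] at this
  rw [this, Finset.sum_congr rfl fun i _ => (hε i).variance_eq]
  simp [variance_id_gaussianReal]

end Noise

/-! ### Whitened operators and rank-one domination -/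

section Reduction

variable {μ μπ μr : KernelSpectrum}

theorem isSingularSystem_of_isEigendecomposition {M : RKHSpace μπ →L[ℝ] RKHSpace μr}
    {φ : ℕ → SeqL2} {ζ : ℕ → ℝ} (h : IsEigendecomposition (whitenedGram M) φ ζ) :
    IsSingularSystem M (fun j => eigenPolicy μπ (φ j)) ζ where
  orthonormal := h.orthonormal.comp_linearIsometryEquiv (sqrtS μπ).symm
  inner_map i j := by
    have h1 : ⟪M (eigenPolicy μπ (φ i)), M (eigenPolicy μπ (φ j))⟫_ℝ =
        ⟪whitenedMap M (φ i), whitenedMap M (φ j)⟫_ℝ :=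
      ((sqrtS μr).inner_map_map _ _).symm
    have h2 : ⟪whitenedMap M (φ i), whitenedMap M (φ j)⟫_ℝ = ⟪φ i, whitenedGram M (φ j)⟫_ℝ :=
      (ContinuousLinearMap.adjoint_inner_right _ _ _).symm
    rw [h1, h2, h.eigen, inner_smul_right, orthonormal_iff_ite.1 h.orthonormal]
    simp
  complete x hx := by
    have h1 : whitenedGram M (sqrtS μπ x) = 0 := h.complete _ fun j => by
      rw [← hx j, ← (sqrtS μπ).inner_map_map, eigenPolicy, LinearIsometryEquiv.apply_symm_apply]
    have h2 : whitenedMap M (sqrtS μπ x) = sqrtS μr (M x) := by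
      change sqrtS μr (M ((sqrtS μπ).symm (sqrtS μπ x))) = _
      rw [LinearIsometryEquiv.symm_apply_apply]
    have h3 : ⟪whitenedMap M (sqrtS μπ x), whitenedMap M (sqrtS μπ x)⟫_ℝ = 0 := by
      rw [← ContinuousLinearMap.adjoint_inner_right]
      change ⟪_, whitenedGram M (sqrtS μπ x)⟫_ℝ = 0
      rw [h1, inner_zero_right]
    rw [inner_self_eq_zero, h2, map_eq_zero_iff _ (sqrtS μr).injective] at h3
    exact h3

/-- A rank-one operator that dominates a multiple of `p pᵀ` is built from a multiple of `p`. -/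
theorem Dominates.exists_eq_smul {c : ℝ} (hc : 0 < c) {q p : RKHSpace μ} (hp : p ≠ 0)
    (h : Dominates c q p) : ∃ α : ℝ, q = α • p ∧ c ≤ α ^ 2 := by
  have hle : ∀ v : SeqL2, c * ⟪p.coeff, v⟫_ℝ ^ 2 ≤ ⟪q.coeff, v⟫_ℝ ^ 2 := fun v => by
    have h1 := ((ContinuousLinearMap.le_def _ _).1 h).inner_nonneg_left v
    simp only [outer, sub_apply, smul_apply,
      InnerProductSpace.rankOne_apply, inner_sub_left, real_inner_smul_left] at h1
    linarith
  have hp' : p.coeff ≠ 0 := fun h0 => hp (RKHSpace.coeff_injective (by rw [h0, map_zero]))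
  have hpp : 0 < ‖p.coeff‖ ^ 2 := by positivity
  -- `v` is a multiple of the component of `p` orthogonal to `q`; testing the Loewner relation on
  -- `v` shows that `v = 0`.
  set v := ‖q.coeff‖ ^ 2 • p.coeff - ⟪q.coeff, p.coeff⟫_ℝ • q.coeff with hv
  have hqv : ⟪q.coeff, v⟫_ℝ = 0 := by
    rw [hv, inner_sub_right, inner_smul_right, inner_smul_right, real_inner_self_eq_norm_sq]
    ring
  have hpv : ⟪p.coeff, v⟫_ℝ = 0 := by
    have := hle v
    rw [hqv] at this
    have : ⟪p.coeff, v⟫_ℝ ^ 2 ≤ 0 := by nlinarith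
    nlinarith [sq_nonneg ⟪p.coeff, v⟫_ℝ]
  have hv0 : v = 0 := by
    rw [← inner_self_eq_zero (𝕜 := ℝ)]
    nth_rewrite 1 [hv]
    rw [inner_sub_left, real_inner_smul_left, real_inner_smul_left, hpv, hqv]
    simp
  have hqp : ⟪q.coeff, p.coeff⟫_ℝ ≠ 0 := fun h0 => by
    have := hle p.coeff
    rw [h0, real_inner_self_eq_norm_sq] at this
    have : 0 < c * (‖p.coeff‖ ^ 2) ^ 2 := by positivity
    linarith
  have hq : q = (‖q.coeff‖ ^ 2 / ⟪q.coeff, p.coeff⟫_ℝ) • p := by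
    apply RKHSpace.coeff_injective
    rw [map_smul, div_eq_inv_mul, mul_smul, sub_eq_zero.1 hv0, smul_smul, inv_mul_cancel₀ hqp,
      one_smul]
  refine ⟨_, hq, ?_⟩
  generalize ‖q.coeff‖ ^ 2 / ⟪q.coeff, p.coeff⟫_ℝ = α at hq
  have h1 := hle p.coeff
  rw [hq, map_smul, real_inner_smul_left, real_inner_self_eq_norm_sq, mul_pow] at h1
  exact le_of_mul_le_mul_right h1 (by positivity)

end Reduction

/-! ### Choice of the tuning parameters and the query set -/

/-- The balance of the tuning parameters: with `J ≈ n^{1/(β+2)}` and `lam = n^{-(β+1)/(β+2)}`, the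
orders `J lam` (bias), `J² / n` (variance) and `(J+1)^{-β}` (tail of the spectrum) all agree with
the squared rate. -/
theorem exploration_rates {β : ℝ} (hβ : 0 < β) {n J : ℕ} (hn : 1 ≤ n)
    (hJ : |(J : ℝ) - (n : ℝ) ^ (1 / (β + 2))| < 1) :
    1 ≤ J ∧ J ≤ n ∧
      J * (n : ℝ) ^ (-((β + 1) / (β + 2))) ≤ 2 * ((n : ℝ) ^ (-(β / (2 * (β + 2))))) ^ 2 ∧
      (J : ℝ) ^ 2 / n ≤ 4 * ((n : ℝ) ^ (-(β / (2 * (β + 2))))) ^ 2 ∧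
      ((J : ℝ) + 1) ^ (-β) ≤ ((n : ℝ) ^ (-(β / (2 * (β + 2))))) ^ 2 := by
  have hN : (1 : ℝ) ≤ n := by exact_mod_cast hn
  have hN0 : (0 : ℝ) < n := by linarith
  set x := (n : ℝ) ^ (1 / (β + 2)) with hx
  have hx1 : 1 ≤ x := Real.one_le_rpow hN (by positivity)
  have hxN : x ≤ n := by
    have : (n : ℝ) ^ (1 / (β + 2)) ≤ (n : ℝ) ^ (1 : ℝ) :=
      Real.rpow_le_rpow_of_exponent_le hN (by rw [div_le_one (by positivity)]; linarith)
    rwa [Real.rpow_one] at this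
  obtain ⟨hl, hu⟩ := abs_lt.1 hJ
  have hR : ((n : ℝ) ^ (-(β / (2 * (β + 2))))) ^ 2 = (n : ℝ) ^ (-(β / (β + 2))) := by
    rw [← Real.rpow_mul_natCast hN0.le]
    congr 1
    push_cast
    field_simp
  have h1 : x * (n : ℝ) ^ (-((β + 1) / (β + 2))) = (n : ℝ) ^ (-(β / (β + 2))) := by
    rw [hx, ← Real.rpow_add hN0]
    congr 1
    field_simp
    ring
  have h2 : x ^ 2 = (n : ℝ) ^ (-(β / (β + 2))) * n := by
    rw [hx, ← Real.rpow_mul_natCast hN0.le]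
    nth_rewrite 3 [← Real.rpow_one (n : ℝ)]
    rw [← Real.rpow_add hN0]
    congr 1
    push_cast
    field_simp
    ring
  have h3 : x ^ (-β) = (n : ℝ) ^ (-(β / (β + 2))) := by
    rw [hx, ← Real.rpow_mul hN0.le]
    congr 1
    field_simp
  rw [hR]
  refine ⟨?_, ?_, ?_, ?_, ?_⟩
  · have : (0 : ℝ) < J := by linarith
    exact_mod_cast this
  · have : (J : ℝ) < n + 1 := by linarith
    exact Nat.lt_succ_iff.1 (by exact_mod_cast this)
  · rw [← h1, ← mul_assoc]
    gcongr
    linarith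
  · rw [div_le_iff₀ hN0, mul_assoc, ← h2]
    nlinarith [(Nat.cast_nonneg J : (0 : ℝ) ≤ J)]
  · rw [← h3]
    exact Real.rpow_le_rpow_of_nonpos (by linarith) (by linarith) (by linarith)

theorem half_le_natFloor {y : ℝ} (hy : 1 ≤ y) : y / 2 ≤ (⌊y⌋₊ : ℝ) := by
  have h1 : (1 : ℝ) ≤ (⌊y⌋₊ : ℝ) := by exact_mod_cast (Nat.one_le_floor_iff y).2 hy
  linarith [Nat.lt_floor_add_one y]

/-- The query set consists of multiples of the leading eigenpolicies, and each of the `J ≤ n`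
directions is queried at least `n / (2 J)` times. -/
theorem IsQuerySet.exists_eq_smul {μ : KernelSpectrum} {C : Set (RKHSpace μ)} {φ : ℕ → SeqL2}
    (hφ : Orthonormal ℝ φ) {c : ℝ} (hc : 0 < c) {J n : ℕ} (hJ : 1 ≤ J) (hJn : J ≤ n)
    {query : Fin n → RKHSpace μ} (h : IsQuerySet C φ c J n query) :
    ∃ (α : ℕ → ℝ) (idx : Fin n → ℕ), (∀ i, idx i < J) ∧
      (∀ i, query i = α (idx i) • eigenPolicy μ (φ (idx i))) ∧ (∀ j < J, c ≤ α j ^ 2) ∧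
      ∀ j < J, (n : ℝ) / (2 * J) ≤ (Finset.univ.filter fun i => idx i = j).card := by
  obtain ⟨q, idx, hq, hcard, hquery⟩ := h
  have hp : ∀ j, eigenPolicy μ (φ j) ≠ 0 := fun j h0 =>
    hφ.ne_zero j ((map_eq_zero_iff _ (sqrtS μ).symm.injective).1 h0)
  have hα : ∀ j, ∃ α : ℝ, j < J → q j = α • eigenPolicy μ (φ j) ∧ c ≤ α ^ 2 := fun j => by
    by_cases hj : j < J
    · obtain ⟨α, h⟩ := (hq j hj).2.exists_eq_smul hc (hp j)
      exact ⟨α, fun _ => h⟩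
    · exact ⟨0, fun h => absurd h hj⟩
  choose α hα using hα
  refine ⟨α, fun i => idx i, fun i => (idx i).2, fun i => ?_, fun j hj => (hα j hj).2,
    fun j hj => ?_⟩
  · rw [hquery, (hα _ (idx i).2).1]
  · have hJ0 : (0 : ℝ) < J := by exact_mod_cast hJ
    -- `n / J ≥ 1`, so rounding down loses at most a factor two.
    have h1 : (n : ℝ) / J / 2 ≤ (⌊(n : ℝ) / J⌋₊ : ℝ) :=
      half_le_natFloor ((one_le_div hJ0).2 (by exact_mod_cast hJn))
    have h2 : (Finset.univ.filter fun i => (idx i : ℕ) = j).card =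
        Nat.card {i // idx i = ⟨j, hj⟩} := by
      rw [Nat.card_eq_fintype_card, Fintype.card_subtype]
      simp only [Fin.ext_iff]
    rw [h2, show (n : ℝ) / (2 * J) = n / J / 2 by field_simp]
    rcases hcard ⟨j, hj⟩ with h3 | h3 <;> rw [h3]
    · exact h1
    · exact h1.trans (by exact_mod_cast Nat.floor_le_ceil _)

end DoublyNonparametric

/-! ### The expected regret -/

theorem corollary2
    -- the noise variance `τ²`, the constant of the regularity assumption and the upper constant of
    -- the power law; the constant `c` of the risk bound depends on these three numbers only
    (τsq : ℝ≥0) (cπ : ℝ) (hcπ : 0 < cπ) (A : ℝ) (hA : 0 < A) :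
    ∃ c : ℝ, 0 < c ∧
      ∀ (β : ℝ) (_ : 0 < β)
        -- policy space, reward space and the map between them
        (μπ μr : KernelSpectrum)
        (M : RKHSpace μπ →L[ℝ] RKHSpace μr) (_ : IsCompactOperator M)
        -- the true reward
        (rstar : RKHSpace μr) (_ : ‖rstar‖ = 1)
        -- the spectrum of `S_π^{-1/2} Mᵀ S_r M S_π^{-1/2}` and its power-law decay
        (φ : ℕ → SeqL2) (ζ : ℕ → ℝ) (_ : IsEigendecomposition (whitenedGram M) φ ζ)
        (a : ℝ) (_ : 0 < a)
        (_ : ∀ j : ℕ, a * ((j : ℝ) + 1) ^ (-β) ≤ ζ j ∧ ζ j ≤ A * ((j : ℝ) + 1) ^ (-β))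
        -- the policy set and an optimal policy
        (C : Set (RKHSpace μπ)) (_ : C ⊆ Metric.closedBall 0 1) (_ : RegularPolicySet C φ cπ)
        (pstar : RKHSpace μπ) (_ : pstar ∈ C) (_ : IsMaxOn (fun p => reward M p rstar) C pstar)
        -- the number of queries, `J = n^{1/(β+2)}` rounded to an integer, and the query set
        (n : ℕ) (_ : 1 ≤ n)
        (J : ℕ) (_ : |(J : ℝ) - (n : ℝ) ^ (1 / (β + 2))| < 1)
        (query : Fin n → RKHSpace μπ) (_ : IsQuerySet C φ cπ J n query)
        -- the oracle noise: independent `N(0, τ²)` variables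
        (Ω : Type*) (_ : MeasurableSpace Ω) (P : Measure Ω) (_ : IsProbabilityMeasure P)
        (ε : Fin n → Ω → ℝ) (_ : ∀ i, HasLaw (ε i) (gaussianReal 0 τsq) P) (_ : iIndepFun ε P)
        -- ridge regression with `λ = n^{-(β+1)/(β+2)}`
        (rhat : Ω → RKHSpace μr)
        (_ : ∀ ω, IsMinOn
          (ridgeObjective M query (fun i => reward M (query i) rstar + ε i ω)
            ((n : ℝ) ^ (-((β + 1) / (β + 2))))) Set.univ (rhat ω))
        -- the plug-in policy
        (phat : Ω → RKHSpace μπ) (_ : ∀ ω, phat ω ∈ C)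
        (_ : ∀ ω, IsMaxOn (fun p => reward M p (rhat ω)) C (phat ω))
        (_ : AEStronglyMeasurable (fun ω => excessRisk M rstar pstar (phat ω)) P),
        Integrable (fun ω => excessRisk M rstar pstar (phat ω)) P ∧
          ∫ ω, excessRisk M rstar pstar (phat ω) ∂P ≤
            c * (n : ℝ) ^ (-(β / (2 * (β + 2)))) := by
  refine ⟨A + (4 + 8 * τsq) / cπ + 1, by positivity, ?_⟩
  intro β hβ μπ μr M _ rstar hr φ ζ hE a ha hζ C hC _ pstar hpstar hmax n hn J hJ query hquery
    Ω _ P _ ε hε hind rhat hrhat phat hphat hphatmax hmeas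
  obtain ⟨hJ1, hJn, hbias, hvar, htail⟩ := exploration_rates hβ hn hJ
  obtain ⟨α, idx, hidx, hq, hα, hm⟩ := hquery.exists_eq_smul hE.orthonormal hcπ hJ1 hJn
  have hsys := isSingularSystem_of_isEigendecomposition hE
  have hn0 : (0 : ℝ) < n := by exact_mod_cast hn
  have hJ0 : (0 : ℝ) < J := by exact_mod_cast hJ1
  have hζ0 : ∀ j, 0 < ζ j := fun j => lt_of_lt_of_le (by positivity) (hζ j).1
  set lam := (n : ℝ) ^ (-((β + 1) / (β + 2))) with hlam
  have hlam0 : 0 < lam := by positivity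
  set R := (n : ℝ) ^ (-(β / (2 * (β + 2)))) with hR
  have hR0 : 0 < R := by positivity
  set m : ℕ → ℝ := fun j => (Finset.univ.filter fun i => idx i = j).card with hmdef
  have hm0 : ∀ j < J, 0 < m j := fun j hj => lt_of_lt_of_le (by positivity) (hm j hj)
  set V : Ω → ℝ := fun ω => ∑ j ∈ Finset.range J,
    (∑ i with idx i = j, ε i ω) ^ 2 / (m j ^ 2 * cπ) with hV
  have herr : ∀ ω, ‖ContinuousLinearMap.adjoint M (rhat ω - rstar)‖ ^ 2 ≤
      R ^ 2 * (A + 4 / cπ) + V ω := fun ω => by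
    refine norm_adjoint_ridge_error_sq_le hsys hζ0 hn hidx hq hcπ hα
      (m₀ := (n : ℝ) / (2 * J)) (by positivity) hm hr hlam0 (hrhat ω) (fun j hj => ?_) ?_
    · have h1 : ((j : ℝ) + 1) ^ (-β) ≤ ((J : ℝ) + 1) ^ (-β) :=
        Real.rpow_le_rpow_of_nonpos (by positivity) (by gcongr) (by linarith)
      have h2 : 0 ≤ R ^ 2 * (4 / cπ) := by positivity
      have h3 := mul_le_mul_of_nonneg_left (h1.trans htail) hA.le
      linarith [(hζ j).2]
    · have h1 : lam * n / (n / (2 * J) * cπ) = 2 * (J * lam) / cπ := by field_simp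
      have h2 : 2 * (J * lam) / cπ ≤ 2 * (2 * R ^ 2) / cπ := by gcongr
      have h3 : R ^ 2 * (A + 4 / cπ) = R ^ 2 * A + 2 * (2 * R ^ 2) / cπ := by ring
      have h4 : 0 ≤ R ^ 2 * A := by positivity
      rw [h1, h3]
      linarith
  have hVint : ∀ j, Integrable
      (fun ω => (∑ i with idx i = j, ε i ω) ^ 2 / (m j ^ 2 * cπ)) P := fun j =>
    (integrable_and_integral_sum_sq hε hind _).1.div_const _
  have hVi : Integrable V P := integrable_finsetSum _ fun j _ => hVint j
  have hVle : ∫ ω, V ω ∂P ≤ R ^ 2 * (8 * τsq / cπ) := by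
    rw [hV, integral_finsetSum _ fun j _ => hVint j]
    have h1 : ∀ j ∈ Finset.range J,
        ∫ ω, (∑ i with idx i = j, ε i ω) ^ 2 / (m j ^ 2 * cπ) ∂P ≤ 2 * J * τsq / (n * cπ) := by
      intro j hj
      have hj' := Finset.mem_range.1 hj
      have h0 := hm0 j hj'
      rw [integral_div, (integrable_and_integral_sum_sq hε hind _).2]
      have h2 : m j * τsq / (m j ^ 2 * cπ) = τsq / (m j * cπ) := by field_simp
      have h3 : 2 * J * τsq / (n * cπ) = τsq / (n / (2 * J) * cπ) := by field_simp
      change m j * τsq / (m j ^ 2 * cπ) ≤ _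
      rw [h2, h3]
      gcongr
      exact hm j hj'
    refine (Finset.sum_le_sum h1).trans ?_
    rw [Finset.sum_const, Finset.card_range, nsmul_eq_mul]
    have h2 : (J : ℝ) * (2 * J * τsq / (n * cπ)) = (J : ℝ) ^ 2 / n * (2 * τsq / cπ) := by
      field_simp
    rw [h2]
    calc (J : ℝ) ^ 2 / n * (2 * τsq / cπ) ≤ 4 * R ^ 2 * (2 * τsq / cπ) := by gcongr
      _ = R ^ 2 * (8 * τsq / cπ) := by ring
  -- `2 g ≤ R + g² / R` reduces the expected regret to the second moment of the error.
  have hΔ : ∀ ω, excessRisk M rstar pstar (phat ω) ≤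
      R + (R ^ 2 * (A + 4 / cπ) + V ω) / R := fun ω => by
    refine (regret_le_two_mul_norm_adjoint hC hpstar (hphat ω) (hphatmax ω)).trans ?_
    have h1 := herr ω
    set g := ‖ContinuousLinearMap.adjoint M (rhat ω - rstar)‖
    have h2 : 2 * g ≤ R + g ^ 2 / R := by
      rw [← sub_nonneg]
      have : R + g ^ 2 / R - 2 * g = (g - R) ^ 2 / R := by field_simp; ring
      rw [this]
      positivity
    have h3 : g ^ 2 / R ≤ (R ^ 2 * (A + 4 / cπ) + V ω) / R := by gcongr
    linarith
  have hΔ0 : ∀ ω, 0 ≤ excessRisk M rstar pstar (phat ω) := fun ω =>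
    sub_nonneg.2 (hmax (hphat ω))
  have hVRi : Integrable (fun ω => (R ^ 2 * (A + 4 / cπ) + V ω) / R) P :=
    ((integrable_const _).add hVi).div_const R
  have hbi : Integrable (fun ω => R + (R ^ 2 * (A + 4 / cπ) + V ω) / R) P :=
    (integrable_const R).add hVRi
  have hint : Integrable (fun ω => excessRisk M rstar pstar (phat ω)) P :=
    hbi.mono' hmeas (Filter.Eventually.of_forall fun ω => by
      rw [Real.norm_of_nonneg (hΔ0 ω)]
      exact hΔ ω)
  refine ⟨hint, (integral_mono hint hbi hΔ).trans ?_⟩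
  rw [integral_add (integrable_const R) hVRi, integral_div,
    integral_add (integrable_const _) hVi, integral_const, integral_const, probReal_univ,
    one_smul, one_smul]
  calc R + (R ^ 2 * (A + 4 / cπ) + ∫ ω, V ω ∂P) / R
      ≤ R + (R ^ 2 * (A + 4 / cπ) + R ^ 2 * (8 * τsq / cπ)) / R := by gcongr
    _ = (A + (4 + 8 * τsq) / cπ + 1) * R := by field_simp; ring
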